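/- A \emph{numbering} is a family $\phi=(\phi_e)_{e\in\mathbb N}$ of partial functions $\phi_e:\mathbb N\rightharpoonup\mathbb N$ such that $(e,x)\mapsto\phi_e(x)$ is partial recursive. A numbering $\phi$ has the \emph{Kolmogorov property} if for every numbering $\psi$ there are a (not necessarily recursive) function $f:\mathbb N\to\mathbb N$ and a positive constant $c$ such that $\phi_{f(e)}=\psi_e$ and $f(e)\le ce+c$ for all $e$. The set of $\phi$-minimal indices is $\mathrm{MIN}_\phi=\{e\in\mathbb N : (\forall j<e)\;\phi_j\ne\phi_e\}$. A set $A\subseteq\mathbb N$ is \emph{$(m,k)$-recursive} if there is a computable function $f:\mathbb N^k\to\{0,1\}^k$ such that for every tuple $(x_1,\dots,x_k)\in\mathbb N^k$ the vectors $f(x_1,\dots,x_k)$ and $(\chi_A(x_1),\dots,\chi_A(x_k))$ coincide in at least $m$ positions, where $\chi_A$ is the characteristic function of $A$. \textbf{Theorem.} For every numbering $\phi$ with the Kolmogorov property and every $k\in\mathbb N$, the set $\mathrm{MIN}_\phi$ is not $(1,k)$-recursive. -/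

import Mathlib

namespace MinimalIndices

/-- A numbering: a family `φ 0, φ 1, …` of partial functions `ℕ → ℕ` such that
`(e, x) ↦ φ e x` is partial recursive. No universality is required. -/
def IsNumbering (φ : ℕ → ℕ →. ℕ) : Prop :=
  Partrec₂ φ

/-- `MIN_φ`, the set of `φ`-minimal indices (equality is equality of partial functions). -/
def MIN (φ : ℕ → ℕ →. ℕ) : Set ℕ :=
  {e | ∀ j < e, φ j ≠ φ e}

/-- `φ` has the Kolmogorov property: `φ` is a numbering, and every numbering `ψ` translates into
`φ` by some function `f`, not necessarily recursive, that is linearly bounded. The constant may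
depend on `ψ`. -/
def HasKolmogorovProperty (φ : ℕ → ℕ →. ℕ) : Prop :=
  IsNumbering φ ∧
    ∀ ψ : ℕ → ℕ →. ℕ, IsNumbering ψ →
      ∃ f : ℕ → ℕ, (∀ e, φ (f e) = ψ e) ∧ ∃ c : ℕ, 0 < c ∧ ∀ e, f e ≤ c * e + c

/-- `A` is `(m,k)`-recursive: some computable function assigns to every `k`-tuple of natural numbers
(repetitions allowed) `k` labels, at least `m` of which are correct, the label `true` being read as
membership in `A` and `false` as non-membership. -/
def IsMKRecursive (m k : ℕ) (A : Set ℕ) : Prop :=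
  ∃ f : (Fin k → ℕ) → (Fin k → Bool), Computable f ∧
    ∀ x : Fin k → ℕ, m ≤ {i : Fin k | f x i = true ↔ x i ∈ A}.ncard

end MinimalIndices

/-! Suppose `f` is always right in at least one position. With d = 2^n, constant functions put at
least d minimal indices into [d, N), where N = O(d). By Sauer–Shelah only polynomially many subsets
of this interval agree somewhere with `f` on every tuple, and greedy choice hits all the dense ones
with O(n) points. Disagreement with `f` is semidecidable, so such a list can be found by search
(`exists_hitsUnrefuted`), and it must contain a minimal index x ≥ 2^n
(`exists_getD_mem_of_hitsUnrefuted`). The numbering taking ⟨n, i⟩ to `φ` at the i-th entry of the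
list for n is translated into `φ` with indices O(⟨n, i⟩) = O(n^2), which is below 2^n for suitable
n. So `φ x` has an index below x, contradicting minimality. -/

/-! ### Counting and hitting sets -/

open Finset in
/-- If a function `f` on `k`-tuples from `U` agrees with each member of `F` in at least one
position, then no `k`-element set is shattered by `F`, so `F` has polynomial size. -/
theorem Finset.card_le_of_agree {k N : ℕ} {U : Finset ℕ} (hU : #U ≤ N) (hN : 0 < N)
    {F : Finset (Finset ℕ)} (hF : ∀ A ∈ F, A ⊆ U) (f : (Fin k → ℕ) → Fin k → Bool)
    (hf : ∀ A ∈ F, ∀ x : Fin k → ℕ, (∀ i, x i ∈ U) → ∃ i, (f x i = true ↔ x i ∈ A)) :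
    #F ≤ k * N ^ k := by
  have hsub : F.shatterer ⊆ (range k).biUnion fun j => U.powersetCard j := by
    intro s hs
    rw [mem_shatterer] at hs
    obtain ⟨A, hA, hsA⟩ := hs.exists_superset
    refine mem_biUnion.2 ⟨#s, mem_range.2 ?_, mem_powersetCard.2 ⟨hsA.trans (hF A hA), rfl⟩⟩
    by_contra! hk
    obtain ⟨t, hts, htk⟩ := exists_subset_card_eq hk
    have ht := hs.mono_right hts
    let x : Fin k → ℕ := fun i => t.equivFinOfCardEq htk |>.symm i
    have hxt : ∀ i, x i ∈ t := fun i => ((t.equivFinOfCardEq htk).symm i).2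
    have hxinj : Function.Injective x := fun i j h =>
      (t.equivFinOfCardEq htk).symm.injective (Subtype.ext h)
    -- Shattering realises the trace opposite to every label of `f` on an enumeration of `t`.
    obtain ⟨B, hB, hBt⟩ := @ht ((univ.filter fun i => f x i = false).image x) (by
      intro y hy
      obtain ⟨i, -, rfl⟩ := mem_image.1 hy
      exact hxt i)
    obtain ⟨i, hi⟩ := hf B hB x fun i => hF A hA (hsA (hts (hxt i)))
    have hmem : x i ∈ B ↔ f x i = false := by
      have : x i ∈ B ↔ x i ∈ t ∩ B := by simp [hxt i]
      rw [this, hBt, mem_image]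
      constructor
      · rintro ⟨j, hj, hji⟩
        rw [← hxinj hji]
        simpa using hj
      · intro h
        exact ⟨i, by simpa using h, rfl⟩
    rw [hmem] at hi
    cases h : f x i <;> simp [h] at hi
  calc #F ≤ #F.shatterer := card_le_card_shatterer F
    _ ≤ #((range k).biUnion fun j => U.powersetCard j) := card_le_card hsub
    _ ≤ #(range k) * N ^ k := card_biUnion_le_card_mul _ _ _ fun j hj => by
        rw [card_powersetCard]
        exact (Nat.choose_le_pow _ _).trans ((Nat.pow_le_pow_left hU j).trans
          (Nat.pow_le_pow_right hN (mem_range.1 hj).le))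
    _ = k * N ^ k := by rw [card_range]

open Finset in
/-- Some element of `U` lies in at least a `1 / q` fraction of the members of `F`. -/
theorem Finset.exists_mem_card_le_mul {q d : ℕ} {U : Finset ℕ} (hU : #U ≤ q * d) (hd : 0 < d)
    {F : Finset (Finset ℕ)} (hF : ∀ A ∈ F, A ⊆ U ∧ d ≤ #A) :
    ∃ x, #F ≤ q * #(F.filter fun A => x ∈ A) := by
  by_contra! h
  have hne : F.Nonempty := card_pos.1 ((Nat.zero_le _).trans_lt (h 0))
  obtain ⟨A, hA⟩ := hne
  have hUne : U.Nonempty := (card_pos.1 (hd.trans_le (hF A hA).2)).mono (hF A hA).1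
  -- Double counting of the incidences between points and sets.
  have hdc : ∑ x ∈ U, #(F.filter fun A => x ∈ A) = ∑ A ∈ F, #(U.filter fun x => x ∈ A) :=
    sum_card_bipartiteAbove_eq_sum_card_bipartiteBelow (fun x A => x ∈ A)
  have h1 : q * (#F * d) ≤ q * ∑ x ∈ U, #(F.filter fun A => x ∈ A) := by
    rw [hdc]
    refine Nat.mul_le_mul_left _ ?_
    rw [← smul_eq_mul]
    refine card_nsmul_le_sum _ _ _ fun A hA => ?_
    rw [filter_mem_eq_inter, inter_eq_right.2 (hF A hA).1]
    exact (hF A hA).2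
  have h2 : q * ∑ x ∈ U, #(F.filter fun A => x ∈ A) < #U * #F := by
    rw [mul_sum, ← smul_eq_mul, ← sum_const]
    exact sum_lt_sum_of_nonempty hUne fun x _ => h x
  have h3 := Nat.mul_le_mul_right (#F) hU
  nlinarith

-- Greedy choice: each new point hits at least a 1/q fraction of the sets still missed.
open Finset in
theorem Finset.exists_list_card_filter_mul_pow_le {q d : ℕ} {U : Finset ℕ} (hU : #U ≤ q * d)
    (hd : 0 < d) {F : Finset (Finset ℕ)} (hF : ∀ A ∈ F, A ⊆ U ∧ d ≤ #A) (m : ℕ) :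
    ∃ L : List ℕ, L.length = m ∧
      #(F.filter fun A => ∀ x ∈ L, x ∉ A) * q ^ m ≤ #F * (q - 1) ^ m := by
  induction m with
  | zero => exact ⟨[], by simp⟩
  | succ m ih =>
    obtain ⟨L, hL, hcard⟩ := ih
    set G := F.filter fun A => ∀ x ∈ L, x ∉ A with hG
    obtain ⟨x, hx⟩ := exists_mem_card_le_mul hU hd (F := G)
      fun A hA => hF A (mem_filter.1 hA).1
    refine ⟨x :: L, by simp [hL], ?_⟩
    have heq : (F.filter fun A => ∀ y ∈ x :: L, y ∉ A) = G.filter fun A => x ∉ A := by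
      ext A
      simp only [hG, mem_filter, List.forall_mem_cons]
      tauto
    rw [heq]
    have hsplit := card_filter_add_card_filter_not (s := G) (fun A => x ∈ A)
    have hstep : #(G.filter fun A => x ∉ A) * q ≤ #G * (q - 1) := by
      rcases q with _ | q
      · simp
      · simp only [Nat.add_sub_cancel]
        nlinarith
    calc #(G.filter fun A => x ∉ A) * q ^ (m + 1)
        = #(G.filter fun A => x ∉ A) * q * q ^ m := by ring
      _ ≤ #G * (q - 1) * q ^ m := Nat.mul_le_mul_right _ hstep
      _ = #G * q ^ m * (q - 1) := by ring
      _ ≤ #F * (q - 1) ^ m * (q - 1) := Nat.mul_le_mul_right _ hcard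
      _ = #F * (q - 1) ^ (m + 1) := by ring

/-- Bernoulli's inequality (1 + 1/p)^n ≥ 1 + n/p, cleared of denominators. -/
theorem Nat.pow_mul_add_le_succ_pow_mul (p n : ℕ) : p ^ n * (p + n) ≤ (p + 1) ^ n * p := by
  induction n with
  | zero => simp
  | succ n ih =>
    calc p ^ (n + 1) * (p + (n + 1)) = p ^ n * (p * (p + n + 1)) := by ring
      _ ≤ p ^ n * ((p + n) * (p + 1)) := Nat.mul_le_mul_left _ (by nlinarith)
      _ = p ^ n * (p + n) * (p + 1) := by ring
      _ ≤ (p + 1) ^ n * p * (p + 1) := Nat.mul_le_mul_right _ ih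
      _ = (p + 1) ^ (n + 1) * p := by ring

theorem Nat.two_mul_pow_le_succ_pow (p : ℕ) : 2 * p ^ (p + 1) ≤ (p + 1) ^ (p + 1) := by
  rcases Nat.eq_zero_or_pos p with rfl | hp
  · simp
  · refine Nat.le_of_mul_le_mul_right ?_ hp
    have h := Nat.pow_mul_add_le_succ_pow_mul p (p + 1)
    nlinarith [Nat.zero_le (p ^ (p + 1))]

open Finset in
/-- A family of fewer than `2 ^ K` subsets of `U`, each of density at least `1 / q`, has a hitting
set of at most `q * K` elements. -/
theorem Finset.exists_hitting_list {q d K : ℕ} {U : Finset ℕ} (hU : #U ≤ q * d)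
    (hd : 0 < d) (hq : 0 < q) {F : Finset (Finset ℕ)} (hF : ∀ A ∈ F, A ⊆ U ∧ d ≤ #A)
    (hK : #F < 2 ^ K) :
    ∃ L : List ℕ, L.length = q * K ∧ ∀ A ∈ F, ∃ x ∈ L, x ∈ A := by
  obtain ⟨L, hL, hcard⟩ := exists_list_card_filter_mul_pow_le hU hd hF (q * K)
  refine ⟨L, hL, ?_⟩
  by_contra! h
  obtain ⟨A, hA, hAL⟩ := h
  have hpos : 0 < #(F.filter fun A => ∀ x ∈ L, x ∉ A) := card_pos.2 ⟨A, mem_filter.2 ⟨hA, hAL⟩⟩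
  obtain ⟨p, rfl⟩ := Nat.exists_eq_succ_of_ne_zero hq.ne'
  -- Each block of q = p + 1 greedy points at least halves the missed sets; K blocks leave none.
  have h2 : 2 ^ K * (p ^ ((p + 1) * K)) ≤ (p + 1) ^ ((p + 1) * K) := by
    rw [pow_mul, pow_mul, ← mul_pow]
    exact Nat.pow_le_pow_left (Nat.two_mul_pow_le_succ_pow p) K
  simp only [Nat.succ_eq_add_one, Nat.add_sub_cancel] at hcard
  have h3 : (p + 1) ^ ((p + 1) * K) ≤ #F * p ^ ((p + 1) * K) :=
    (Nat.le_mul_of_pos_left _ hpos).trans hcard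
  have h4 : 0 < (p + 1) ^ ((p + 1) * K) := by positivity
  have h5 : 0 < p ^ ((p + 1) * K) := Nat.pos_of_ne_zero fun h0 => by
    rw [h0] at h3; omega
  have h6 := Nat.mul_lt_mul_of_pos_right hK h5
  omega

/-! ### Computability of bounded quantifiers and counting -/

theorem Primrec.nat_pow : Primrec₂ ((· ^ ·) : ℕ → ℕ → ℕ) :=
  Primrec₂.unpaired'.1 Nat.Primrec.pow

theorem Primrec.nat_testBit : Primrec₂ Nat.testBit := by
  have h : PrimrecRel fun S i : ℕ => S / 2 ^ i % 2 = 1 :=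
    Primrec.eq.comp₂ (Primrec.nat_mod.comp₂ (Primrec.nat_div.comp₂ Primrec₂.left
      (Primrec.nat_pow.comp₂ (Primrec₂.const 2) Primrec₂.right)) (Primrec₂.const 2))
      (Primrec₂.const 1)
  exact h.decide.of_eq fun S i => (Nat.testBit_eq_decide_div_mod_eq).symm

theorem Computable.all_range {α : Type*} [Primcodable α] {p : α → ℕ → Bool} {b : α → ℕ}
    (hp : Computable₂ p) (hb : Computable b) :
    Computable fun a => (List.range (b a)).all (p a) := by
  have h : Computable fun a => Nat.rec (motive := fun _ => Bool) true
      (fun i acc => acc && p a i) (b a) :=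
    Computable.nat_rec hb (Computable.const true)
      ((Primrec.and.to_comp.comp (Computable.snd.comp Computable.snd)
        (hp.comp Computable.fst (Computable.fst.comp Computable.snd))).to₂)
  refine h.of_eq fun a => ?_
  induction b a with
  | zero => rfl
  | succ n ih => simp [List.range_succ, ih]

theorem Computable.any_range {α : Type*} [Primcodable α] {p : α → ℕ → Bool} {b : α → ℕ}
    (hp : Computable₂ p) (hb : Computable b) :
    Computable fun a => (List.range (b a)).any (p a) :=
  (Primrec.not.to_comp.comp
    (Computable.all_range (Primrec.not.to_comp.comp₂ hp) hb)).of_eq fun a => by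
      simp [List.not_all_eq_any_not]

theorem Computable.count {α : Type*} [Primcodable α] {p : α → ℕ → Bool} {b : α → ℕ}
    (hp : Computable₂ p) (hb : Computable b) :
    Computable fun a => Nat.count (fun i => p a i = true) (b a) := by
  have h : Computable fun a => Nat.rec (motive := fun _ => ℕ) 0
      (fun i acc => acc + bif p a i then 1 else 0) (b a) :=
    Computable.nat_rec hb (Computable.const 0)
      ((Primrec.nat_add.to_comp.comp (Computable.snd.comp Computable.snd)
        (Computable.cond (hp.comp Computable.fst (Computable.fst.comp Computable.snd))
          (Computable.const 1) (Computable.const 0))).to₂)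
  refine h.of_eq fun a => ?_
  induction b a with
  | zero => simp
  | succ n ih =>
    rw [Nat.count_succ, ← ih]
    simp [Bool.cond_eq_ite]

/-! ### A decidable test for hitting lists -/

namespace MinimalIndices

/-- An enumeration of all `k`-tuples. -/
def tuple (k t : ℕ) : Fin k → ℕ := fun i => (Denumerable.ofNat (List ℕ) t).getD i 0

theorem tuple_surjective (k : ℕ) : Function.Surjective (tuple k) := fun x =>
  ⟨Encodable.encode (List.ofFn x), by
    funext i
    simp [tuple, List.getD_eq_getElem?_getD]⟩

theorem primrec_tuple_apply (k : ℕ) : Primrec₂ fun (t : ℕ) (i : Fin k) => tuple k t i :=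
  (Primrec.list_getD 0).comp ((Primrec.ofNat (List ℕ)).comp Primrec.fst)
    (Primrec.fin_val.comp Primrec.snd)

/-- The tuple with code `t` has entries below `N` and is labelled by `f` in a way that differs in
every position from the set with bitmask `S`. -/
def refutes {k : ℕ} (f : (Fin k → ℕ) → Fin k → Bool) (N S t : ℕ) : Bool :=
  decide (f (tuple k t) = fun i => !S.testBit (tuple k t i)) &&
    decide ((fun i => decide (tuple k t i < N)) = fun _ : Fin k => true)

theorem refutes_iff {k : ℕ} {f : (Fin k → ℕ) → Fin k → Bool} {N S t : ℕ} :
    refutes f N S t = true ↔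
      (∀ i, f (tuple k t) i = !S.testBit (tuple k t i)) ∧ ∀ i, tuple k t i < N := by
  simp [refutes, funext_iff]

theorem computable_refutes {k : ℕ} {f : (Fin k → ℕ) → Fin k → Bool} (hf : Computable f) :
    Computable fun a : (ℕ × ℕ) × ℕ => refutes f a.1.1 a.1.2 a.2 := by
  have happ : Primrec fun a : ((ℕ × ℕ) × ℕ) × Fin k => tuple k a.1.2 a.2 :=
    (primrec_tuple_apply k).comp (Primrec.snd.comp Primrec.fst) Primrec.snd
  have hS : Primrec fun a : ((ℕ × ℕ) × ℕ) × Fin k => a.1.1.2 :=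
    Primrec.snd.comp (Primrec.fst.comp Primrec.fst)
  have hN : Primrec fun a : ((ℕ × ℕ) × ℕ) × Fin k => a.1.1.1 :=
    Primrec.fst.comp (Primrec.fst.comp Primrec.fst)
  have hbits : Primrec fun a : (ℕ × ℕ) × ℕ => fun i => !a.1.2.testBit (tuple k a.2 i) :=
    Primrec.fin_curry.2 (Primrec.not.comp (Primrec.nat_testBit.comp hS happ)).to₂
  have hlt : Primrec fun a : (ℕ × ℕ) × ℕ => fun i => decide (tuple k a.2 i < a.1.1) :=
    Primrec.fin_curry.2 (Primrec.nat_lt.decide.comp happ hN).to₂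
  have htuple : Primrec (tuple k) := Primrec.fin_curry.2 (primrec_tuple_apply k)
  have heq : Computable₂ fun u v : Fin k → Bool => decide (u = v) := Primrec.eq.decide.to_comp
  have hleft : Computable fun a : (ℕ × ℕ) × ℕ =>
      decide (f (tuple k a.2) = fun i => !a.1.2.testBit (tuple k a.2 i)) :=
    heq.comp (hf.comp (htuple.to_comp.comp Computable.snd)) hbits.to_comp
  have hright : Computable fun a : (ℕ × ℕ) × ℕ =>
      decide ((fun i => decide (tuple k a.2 i < a.1.1)) = fun _ : Fin k => true) :=
    heq.comp hlt.to_comp (Computable.const _)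
  exact Primrec.and.to_comp.comp hleft hright

/-- The first `m` entries of the list `w.2` hit, in `[d, N)`, every set with at least `d` elements
in `[d, N)` whose bitmask is not refuted by any tuple with code below `w.1`. -/
def hitsUnrefuted {k : ℕ} (f : (Fin k → ℕ) → Fin k → Bool) (d N m : ℕ) (w : ℕ × List ℕ) : Bool :=
  (List.range (2 ^ N)).all fun S =>
    (List.range w.1).any (refutes f N S) ||
    (decide (Nat.count (fun x => (decide (d ≤ x) && S.testBit x) = true) N < d) ||
    (List.range m).any fun i => decide (d ≤ w.2.getD i 0) && S.testBit (w.2.getD i 0))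

theorem hitsUnrefuted_iff {k : ℕ} {f : (Fin k → ℕ) → Fin k → Bool} {d N m : ℕ} {w : ℕ × List ℕ} :
    hitsUnrefuted f d N m w = true ↔ ∀ S < 2 ^ N,
      (∃ t < w.1, refutes f N S t = true) ∨
      Nat.count (fun x => d ≤ x ∧ S.testBit x = true) N < d ∨
      ∃ i < m, d ≤ w.2.getD i 0 ∧ S.testBit (w.2.getD i 0) = true := by
  simp [hitsUnrefuted]

theorem computable_hitsUnrefuted {k : ℕ} {f : (Fin k → ℕ) → Fin k → Bool} (hf : Computable f)
    {d N m : ℕ → ℕ} (hd : Computable d) (hN : Computable N) (hm : Computable m) :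
    Computable₂ fun n w => hitsUnrefuted f (d n) (N n) (m n) w := by
  have hle : Computable₂ fun a b : ℕ => decide (a ≤ b) := Primrec.nat_le.decide.to_comp
  have hlt : Computable₂ fun a b : ℕ => decide (a < b) := Primrec.nat_lt.decide.to_comp
  have hbit := Primrec.nat_testBit.to_comp
  have hget : Computable₂ fun (l : List ℕ) i => l.getD i 0 := (Primrec.list_getD 0).to_comp
  have hn1 : Computable fun a : (ℕ × (ℕ × List ℕ)) × ℕ => a.1.1 :=
    Computable.fst.comp Computable.fst
  have hn2 : Computable fun a : ((ℕ × (ℕ × List ℕ)) × ℕ) × ℕ => a.1.1.1 :=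
    hn1.comp Computable.fst
  have hS : Computable fun a : ((ℕ × (ℕ × List ℕ)) × ℕ) × ℕ => a.1.2 :=
    Computable.snd.comp Computable.fst
  have hent : Computable fun a : ((ℕ × (ℕ × List ℕ)) × ℕ) × ℕ => a.1.1.2.2.getD a.2 0 :=
    hget.comp (Computable.snd.comp (Computable.snd.comp (Computable.fst.comp Computable.fst)))
      Computable.snd
  have hrefuted : Computable fun a : (ℕ × (ℕ × List ℕ)) × ℕ =>
      (List.range a.1.2.1).any (refutes f (N a.1.1) a.2) := by
    refine Computable.any_range (p := fun (a : (ℕ × (ℕ × List ℕ)) × ℕ) t =>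
      refutes f (N a.1.1) a.2 t) ?_ (Computable.fst.comp (Computable.snd.comp Computable.fst))
    have harg : Computable fun a : ((ℕ × (ℕ × List ℕ)) × ℕ) × ℕ =>
        ((N a.1.1.1, a.1.2), a.2) := Computable.pair (Computable.pair (hN.comp hn2) hS) Computable.snd
    exact ((computable_refutes hf).comp harg).to₂
  have hcount : Computable fun a : (ℕ × (ℕ × List ℕ)) × ℕ =>
      Nat.count (fun x => (decide (d a.1.1 ≤ x) && a.2.testBit x) = true) (N a.1.1) := by
    refine Computable.count (p := fun (a : (ℕ × (ℕ × List ℕ)) × ℕ) x =>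
      decide (d a.1.1 ≤ x) && a.2.testBit x) ?_ (hN.comp hn1)
    exact Primrec.and.to_comp.comp (hle.comp (hd.comp hn2) Computable.snd)
      (hbit.comp hS Computable.snd)
  have hhit : Computable fun a : (ℕ × (ℕ × List ℕ)) × ℕ => (List.range (m a.1.1)).any fun i =>
      decide (d a.1.1 ≤ a.1.2.2.getD i 0) && a.2.testBit (a.1.2.2.getD i 0) := by
    refine Computable.any_range (p := fun (a : (ℕ × (ℕ × List ℕ)) × ℕ) i =>
      decide (d a.1.1 ≤ a.1.2.2.getD i 0) && a.2.testBit (a.1.2.2.getD i 0)) ?_ (hm.comp hn1)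
    exact Primrec.and.to_comp.comp (hle.comp (hd.comp hn2) hent) (hbit.comp hS hent)
  have hsmall : Computable fun a : (ℕ × (ℕ × List ℕ)) × ℕ => decide
      (Nat.count (fun x => (decide (d a.1.1 ≤ x) && a.2.testBit x) = true) (N a.1.1) < d a.1.1) :=
    hlt.comp hcount (hd.comp hn1)
  have hbound : Computable fun a : ℕ × (ℕ × List ℕ) => 2 ^ N a.1 :=
    Primrec.nat_pow.to_comp.comp (Computable.const 2) (hN.comp Computable.fst)
  exact Computable.all_range (α := ℕ × (ℕ × List ℕ))
    (Primrec.or.to_comp.comp hrefuted (Primrec.or.to_comp.comp hsmall hhit)).to₂ hbound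

end MinimalIndices

/-! ### Search, density of minimal indices, and the contradiction -/

/-- Unbounded search for a witness of a computable condition. -/
theorem Partrec.exists_search {α β : Type*} [Primcodable α] [Primcodable β] {p : α → β → Bool}
    (hp : Computable₂ p) :
    ∃ g : α →. β, Partrec g ∧ (∀ a, ∀ b ∈ g a, p a b = true) ∧
      ∀ a b, p a b = true → (g a).Dom := by
  have hh : Computable₂ fun (a : α) (t : ℕ) => (Encodable.decode (α := β) t).bind fun b =>
      bif p a b then some b else Option.none :=
    Computable.option_bind (Computable.decode.comp Computable.snd)
      (Computable.cond (hp.comp (Computable.fst.comp Computable.fst) Computable.snd)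
        (Computable.option_some.comp Computable.snd) (Computable.const Option.none)).to₂
  refine ⟨_, Partrec.rfindOpt hh, fun a b hb => ?_, fun a b hb => ?_⟩
  · obtain ⟨t, ht⟩ := Nat.rfindOpt_spec hb
    simp only [Option.mem_def, Option.bind_eq_some_iff, Bool.cond_eq_ite] at ht
    obtain ⟨b', -, hb'⟩ := ht
    split_ifs at hb' with hpb
    cases hb'
    exact hpb
  · exact Nat.rfindOpt_dom.2 ⟨Encodable.encode b, b, by simp [hb]⟩

namespace MinimalIndices

/-- The constant functions occupy linearly many minimal indices. -/
theorem HasKolmogorovProperty.exists_dense_subset_MIN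
    {φ : ℕ → ℕ →. ℕ} (hφ : HasKolmogorovProperty φ) :
    ∃ c, ∀ d, ∃ A ⊆ Finset.Ico d (2 * c * d + 1), d ≤ A.card ∧ ∀ x ∈ A, x ∈ MIN φ := by
  classical
  obtain ⟨f, hf, c, -, hfc⟩ := hφ.2 (fun e _ => Part.some e) Computable.fst.partrec
  have hex : ∀ e, ∃ j, φ j = fun _ => Part.some e := fun e => ⟨f e, hf e⟩
  let g : ℕ → ℕ := fun e => Nat.find (hex e)
  have hg : ∀ e, φ (g e) = fun _ => Part.some e := fun e => Nat.find_spec (hex e)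
  have hgle : ∀ e, g e ≤ c * e + c := fun e => (Nat.find_min' (hex e) (hf e)).trans (hfc e)
  have hginj : Function.Injective g := fun a b hab => by
    have h := congrFun ((hg a).symm.trans ((congrArg φ hab).trans (hg b))) 0
    exact Part.some_inj.1 h
  have hgmin : ∀ e, g e ∈ MIN φ := fun e j hj h => Nat.find_min (hex e) hj (h.trans (hg e))
  -- Of the least indices of the first 2d constants, at most d lie below d.
  refine ⟨c, fun d => ⟨((Finset.range (2 * d)).image g) \ Finset.range d, ?_, ?_, ?_⟩⟩
  · intro x hx
    simp only [Finset.mem_sdiff, Finset.mem_image, Finset.mem_range, not_lt] at hx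
    obtain ⟨⟨e, he, rfl⟩, hx⟩ := hx
    refine Finset.mem_Ico.2 ⟨hx, Nat.lt_succ_of_le ((hgle e).trans ?_)⟩
    calc c * e + c = c * (e + 1) := by ring
      _ ≤ c * (2 * d) := Nat.mul_le_mul_left _ he
      _ = 2 * c * d := by ring
  · have h := Finset.le_card_sdiff (Finset.range d) ((Finset.range (2 * d)).image g)
    rw [Finset.card_image_of_injective _ hginj, Finset.card_range, Finset.card_range] at h
    omega
  · intro x hx
    obtain ⟨e, -, rfl⟩ := Finset.mem_image.1 (Finset.mem_sdiff.1 hx).1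
    exact hgmin e

theorem count_eq_card_filter_Ico (d N S : ℕ) :
    Nat.count (fun x => d ≤ x ∧ S.testBit x = true) N =
      ((Finset.Ico d N).filter fun x => S.testBit x = true).card := by
  rw [Nat.count_eq_card_filter_range]
  congr 1
  ext x
  simp only [Finset.mem_filter, Finset.mem_range, Finset.mem_Ico]
  tauto

/-- This makes the search halt: the never-refuted dense sets are few enough to share a hitting list,
and one bound on tuple codes covers the finitely many refutable masks. -/
theorem exists_hitsUnrefuted {k q d N K : ℕ} (f : (Fin k → ℕ) → Fin k → Bool) (hd : 0 < d)
    (hq : 0 < q) (hN : N ≤ q * d) (hN0 : 0 < N) (hK : k * N ^ k < 2 ^ K) :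
    ∃ w, hitsUnrefuted f d N (q * K) w = true := by
  classical
  let F : Finset (Finset ℕ) := (Finset.Ico d N).powerset.filter fun A => d ≤ A.card ∧
    ∀ x : Fin k → ℕ, (∀ i, x i ∈ Finset.Ico d N) → ∃ i, (f x i = true ↔ x i ∈ A)
  have hmem : ∀ A ∈ F, A ⊆ Finset.Ico d N ∧ d ≤ A.card ∧
      ∀ x : Fin k → ℕ, (∀ i, x i ∈ Finset.Ico d N) → ∃ i, (f x i = true ↔ x i ∈ A) :=
    fun A hA => by simpa [F] using hA
  have hU : (Finset.Ico d N).card ≤ N := by simp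
  have hF := Finset.card_le_of_agree hU hN0 (fun A hA => (hmem A hA).1) f
    fun A hA => (hmem A hA).2.2
  obtain ⟨L, hL, hhit⟩ := Finset.exists_hitting_list (hU.trans hN) hd hq
    (fun A hA => ⟨(hmem A hA).1, (hmem A hA).2.1⟩) (hF.trans_lt hK)
  have hcode : ∀ S, ∃ t, (∃ t, refutes f N S t = true) → refutes f N S t = true := fun S => by
    by_cases h : ∃ t, refutes f N S t = true
    · exact ⟨h.choose, fun _ => h.choose_spec⟩
    · exact ⟨0, fun h' => absurd h' h⟩
  choose t ht using hcode
  refine ⟨((Finset.range (2 ^ N)).sup t + 1, L), hitsUnrefuted_iff.2 fun S hS => ?_⟩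
  by_cases href : ∃ t, refutes f N S t = true
  · exact Or.inl ⟨t S, Nat.lt_succ_of_le (Finset.le_sup (f := t) (Finset.mem_range.2 hS)),
      ht S href⟩
  · refine Or.inr ?_
    rw [count_eq_card_filter_Ico]
    refine or_iff_not_imp_left.2 fun hbig => ?_
    have hA : ((Finset.Ico d N).filter fun x => S.testBit x = true) ∈ F := by
      refine Finset.mem_filter.2 ⟨Finset.mem_powerset.2 (Finset.filter_subset _ _),
        not_lt.1 hbig, fun x hx => ?_⟩
      by_contra! hdis
      obtain ⟨s, rfl⟩ := tuple_surjective k x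
      refine href ⟨s, refutes_iff.2 ⟨fun i => ?_, fun i => (Finset.mem_Ico.1 (hx i)).2⟩⟩
      have h := hdis i
      rw [Finset.mem_filter] at h
      have hxi := hx i
      cases h1 : f (tuple k s) i <;> cases h2 : S.testBit (tuple k s i) <;> simp_all
    obtain ⟨y, hyL, hyA⟩ := hhit _ hA
    obtain ⟨i, hi, rfl⟩ := List.mem_iff_getElem.1 hyL
    obtain ⟨hy1, hy2⟩ := Finset.mem_filter.1 hyA
    refine ⟨i, hL ▸ hi, ?_⟩
    rw [List.getD_eq_getElem _ _ hi]
    exact ⟨(Finset.mem_Ico.1 hy1).1, hy2⟩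

/-- Every set labelled correctly by `f` in some position of every tuple is hit. -/
theorem exists_getD_mem_of_hitsUnrefuted {k d N m : ℕ} {f : (Fin k → ℕ) → Fin k → Bool}
    {w : ℕ × List ℕ} (hw : hitsUnrefuted f d N m w = true) {M : Set ℕ}
    (hM : ∀ x : Fin k → ℕ, ∃ i, (f x i = true ↔ x i ∈ M)) {A : Finset ℕ}
    (hAU : A ⊆ Finset.Ico d N) (hAd : d ≤ A.card) (hAM : ∀ x ∈ A, x ∈ M) :
    ∃ i < m, d ≤ w.2.getD i 0 ∧ w.2.getD i 0 ∈ M := by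
  classical
  -- The mask of `M` below `N` is never refuted and is dense, so only the hitting alternative
  -- survives.
  let S := Nat.ofBits fun i : Fin N => decide ((i : ℕ) ∈ M)
  have hbit : ∀ y, S.testBit y = true ↔ y < N ∧ y ∈ M := fun y => by
    by_cases hy : y < N
    · simp [S, Nat.testBit_ofBits_lt _ _ hy, hy]
    · simp [S, Nat.testBit_ofBits_ge _ _ (not_lt.1 hy), hy]
  rcases hitsUnrefuted_iff.1 hw S (Nat.ofBits_lt_two_pow _) with ⟨t, -, ht⟩ | hsmall | h
  · obtain ⟨h1, h2⟩ := refutes_iff.1 ht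
    obtain ⟨i, hi⟩ := hM (tuple k t)
    have h3 := hbit (tuple k t i)
    rw [h1 i] at hi
    have h4 := h2 i
    cases h : S.testBit (tuple k t i) <;> simp_all
  · rw [count_eq_card_filter_Ico] at hsmall
    refine absurd (Finset.card_le_card fun x hx => ?_) (not_le.2 (hsmall.trans_le hAd))
    exact Finset.mem_filter.2 ⟨hAU hx, (hbit x).2 ⟨(Finset.mem_Ico.1 (hAU hx)).2, hAM x hx⟩⟩
  · obtain ⟨i, him, hi, hiS⟩ := h
    exact ⟨i, him, hi, ((hbit _).1 hiS).2⟩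

/-- Pairing grows quadratically and i is linear in n, so 2^n eventually dominates. -/
theorem exists_mul_pair_lt_two_pow (C a b : ℕ) :
    ∃ n, ∀ i < a * (b + n), C * Nat.pair n i + C < 2 ^ n := by
  set M := a * b + a + 2 with hM
  set D := C * (M ^ 2 + 1) with hD
  have hlim := tendsto_pow_const_div_const_pow_of_one_lt 2 (r := (2 : ℝ)) one_lt_two
  have hev := hlim.eventually (gt_mem_nhds (show (0 : ℝ) < 1 / (D + 1) by positivity))
  obtain ⟨n, hn, hn1⟩ := (hev.and (Filter.eventually_ge_atTop 1)).exists
  rw [div_lt_div_iff₀ (by positivity) (by positivity), one_mul] at hn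
  have hlt : n ^ 2 * (D + 1) < 2 ^ n := by exact_mod_cast hn
  refine ⟨n, fun i hi => ?_⟩
  have hmax : max n i + 1 ≤ M * n := by
    have h1 : a * b ≤ a * b * n := Nat.le_mul_of_pos_right _ hn1
    have h2 : M * n = a * b * n + a * n + 2 * n := by rw [hM]; ring
    rw [mul_add] at hi
    omega
  have hpair : Nat.pair n i ≤ M ^ 2 * n ^ 2 := by
    rw [← mul_pow]
    exact (Nat.pair_lt_max_add_one_sq n i).le.trans (Nat.pow_le_pow_left hmax 2)
  have hone : 1 ≤ n ^ 2 := Nat.one_le_pow _ _ hn1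
  calc C * Nat.pair n i + C ≤ C * (M ^ 2 * n ^ 2) + C * n ^ 2 :=
        add_le_add (Nat.mul_le_mul_left _ hpair) (Nat.le_mul_of_pos_right _ hone)
    _ = n ^ 2 * D := by rw [hD]; ring
    _ ≤ n ^ 2 * (D + 1) := Nat.mul_le_mul_left _ (Nat.le_succ _)
    _ < 2 ^ n := hlt

/-- The minimal indices of a numbering with the Kolmogorov property are not `(1, k)`-recursive. -/
theorem HasKolmogorovProperty.not_isMKRecursive_MIN {φ : ℕ → ℕ →. ℕ}
    (hφ : HasKolmogorovProperty φ) (k : ℕ) : ¬ IsMKRecursive 1 k (MIN φ) := by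
  rintro ⟨f, hf, hcorrect⟩
  have hM : ∀ x : Fin k → ℕ, ∃ i, (f x i = true ↔ x i ∈ MIN φ) := fun x =>
    Set.nonempty_of_ncard_ne_zero (Nat.one_le_iff_ne_zero.1 (hcorrect x))
  obtain ⟨c, hdense⟩ := hφ.exists_dense_subset_MIN
  set q := 2 * c + 1 with hq
  -- Chosen so that k < 2^k and N ≤ 2^(q+n) give k * N^k < 2^K, with K linear in n.
  let K : ℕ → ℕ := fun n => k * (q + 1 + n)
  let d : ℕ → ℕ := fun n => 2 ^ n
  let N : ℕ → ℕ := fun n => 2 * c * d n + 1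
  have hd : Primrec d := Primrec.nat_pow.comp (Primrec.const 2) Primrec.id
  have hN : Primrec N :=
    Primrec.nat_add.comp (Primrec.nat_mul.comp (Primrec.const _) hd) (Primrec.const 1)
  have hm : Primrec fun n => q * K n :=
    Primrec.nat_mul.comp (Primrec.const _) (Primrec.nat_mul.comp (Primrec.const _)
      (Primrec.nat_add.comp (Primrec.const _) Primrec.id))
  obtain ⟨g, hg, hgsound, hgdom⟩ := Partrec.exists_search
    (computable_hitsUnrefuted hf hd.to_comp hN.to_comp hm.to_comp)
  let ψ : ℕ → ℕ →. ℕ := fun e x => (g e.unpair.1).bind fun w => φ (w.2.getD e.unpair.2 0) x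
  have hunpair : Computable Nat.unpair := Computable.unpair
  have hψ : IsNumbering ψ := by
    have hentry : Computable fun a : (ℕ × ℕ) × (ℕ × List ℕ) => a.2.2.getD a.1.1.unpair.2 0 :=
      (Primrec.list_getD 0).to_comp.comp (Computable.snd.comp Computable.snd)
        (Computable.snd.comp (hunpair.comp (Computable.fst.comp Computable.fst)))
    exact Partrec.bind (hg.comp (Computable.fst.comp (hunpair.comp Computable.fst)))
      (Partrec₂.comp hφ.1 hentry (Computable.snd.comp Computable.fst)).to₂
  obtain ⟨h, hh, C, -, hC⟩ := hφ.2 ψ hψ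
  obtain ⟨n, hn⟩ := exists_mul_pair_lt_two_pow C (q * k) (q + 1)
  have hd0 : 0 < d n := by positivity
  have hNle : N n ≤ q * d n := by
    simp only [N, hq, add_mul, one_mul]
    omega
  have hpoly : k * N n ^ k < 2 ^ K n := by
    have h1 : N n ≤ 2 ^ (q + n) := hNle.trans <| by
      rw [pow_add]
      exact Nat.mul_le_mul_right _ Nat.lt_two_pow_self.le
    calc k * N n ^ k ≤ k * (2 ^ (q + n)) ^ k := by gcongr
      _ < 2 ^ k * (2 ^ (q + n)) ^ k := by
        gcongr
        exact Nat.lt_two_pow_self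
      _ = 2 ^ K n := by
        rw [← mul_pow, ← pow_succ', ← pow_mul]
        congr 1
        simp only [K]
        ring
  obtain ⟨w₀, hw₀⟩ := exists_hitsUnrefuted f hd0 (by omega) hNle (Nat.succ_pos _) hpoly
  have hdom := hgdom n w₀ hw₀
  set w := (g n).get hdom
  obtain ⟨A, hAU, hAd, hAM⟩ := hdense (d n)
  obtain ⟨i, him, hdi, hmin⟩ :=
    exists_getD_mem_of_hitsUnrefuted (hgsound n w (Part.get_mem hdom)) hM hAU hAd hAM
  -- The translated index lies below 2^n, hence below the minimal list entry, yet computes the same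
  -- function.
  refine hmin (h (Nat.pair n i)) ?_ ?_
  · refine ((hC _).trans_lt (hn i (him.trans_eq ?_))).trans_le hdi
    simp only [K]
    ring
  · rw [hh]
    funext x
    simp only [ψ, Nat.unpair_pair]
    rw [Part.bind_of_mem (Part.get_mem hdom)]

end MinimalIndices

theorem theoremt (φ : ℕ → ℕ →. ℕ) (hφ : MinimalIndices.HasKolmogorovProperty φ) (k : ℕ) :
    ¬ MinimalIndices.IsMKRecursive 1 k (MinimalIndices.MIN φ) := by
  exact hφ.not_isMKRecursive_MIN k
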